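/- Let $n\in\mathbb N$, let $A,B\in\mathbb R^{n\times n}$, $b,E\in\mathbb R^n$, $C\in\mathbb R^{1\times n}$, and let $\underline u,\bar u\in\mathbb R$, $\mathcal U=[\underline u,\bar u]$. Let $\mathrm{sat}(s)=\bar u$ for $s\ge\bar u$, $\mathrm{sat}(s)=s$ for $s\in\mathcal U$, and $\mathrm{sat}(s)=\underline u$ for $s\le\underline u$. For $u\in\mathcal U$ put $F_u=A+Bu$, $\pi(u)=-F_u^{-1}(bu+E)$ and $g_u=B\pi(u)+b$. Assume that for every $u\in\mathcal U$ the matrix $F_u$ is Hurwitz (all its eigenvalues have negative real part) and $CF_u^{-1}g_u\neq0$. Let $r\in\mathbb R$, $u_{ss}\in(\underline u,\bar u)$ and $x_{ss}\in\mathbb R^n$ satisfy $$0=(A+Bu_{ss})x_{ss}+bu_{ss}+E,\qquad 0=Cx_{ss}-r .$$ Let $\Upsilon$ be a symmetric positive definite matrix, let $P$ be a solution of $F_{u_{ss}}^\top P+PF_{u_{ss}}=-2\Upsilon$, let $M=CF_{u_{ss}}^{-1}$, and let $$\phi(x,z)=-\big(B(x-x_{ss})+g_{u_{ss}}\big)^\top\Big[k_p(x-x_{ss})^\top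 P-k_i\big(z-M(x-x_{ss})\big)M\Big]^\top .$$ Then for all $k_p>0$ and $k_i>0$ the point $(x_{ss},0)$ is a globally asymptotically stable and locally exponentially stable equilibrium of the closed-loop system $$\dot x=Ax+(Bx+b)\,\mathrm{sat}(u)+E,\qquad \dot z=Cx-r,\qquad u=u_{ss}+\phi(x,z).$$ Here global asymptotic stability means that every initial state has a solution on $[0,\infty)$, that the equilibrium is Lyapunov stable, and that every solution on $[0,\infty)$ converges to it. Local exponential stability means that there are $\delta,c,\lambda>0$ such that every initial state at distance less than $\delta$ from the equilibrium has a solution on $[0,\infty)$, and every solution $\xi$ on $[0,\infty)$ starting at distance less than $\delta$ from the equilibrium $p=(x_{ss},0)$ satisfies $|\xi(t)-p|\le c\,e^{-\lambda t}|\xi(0)-p|$ for all $t\ge0$. -/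

import Mathlib

open scoped Matrix

noncomputable section

/-- A real square matrix is Hurwitz if all its (complex) eigenvalues have negative real part. -/
def IsHurwitz {n : ℕ} (F : Matrix (Fin n) (Fin n) ℝ) : Prop :=
  ∀ μ ∈ spectrum ℂ (F.map (algebraMap ℝ ℂ)), μ.re < 0

/-- The (possibly asymmetric) saturation with levels `lo ≤ hi`; see `sat_of_ge`, `sat_of_mem`,
`sat_of_le` for the three branches. -/
def sat (lo hi s : ℝ) : ℝ := max lo (min hi s)

theorem sat_of_ge {lo hi s : ℝ} (h : lo ≤ hi) (hs : hi ≤ s) : sat lo hi s = hi := by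
  simp [sat, hs, h]

theorem sat_of_mem {lo hi s : ℝ} (hs : s ∈ Set.Icc lo hi) : sat lo hi s = s := by
  simp [sat, hs.1, hs.2]

theorem sat_of_le {lo hi s : ℝ} (h : lo ≤ hi) (hs : s ≤ lo) : sat lo hi s = lo := by
  simp [sat, hs, hs.trans h]

/-- The data of the single-input single-output bilinear plant
`x' = A x + (B x + b) sat(u) + E`, `e = C x - r`; the row `C` is stored as a vector. -/
structure BilinearSystem (n : ℕ) where
  A : Matrix (Fin n) (Fin n) ℝ
  B : Matrix (Fin n) (Fin n) ℝ
  b : Fin n → ℝ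
  E : Fin n → ℝ
  C : Fin n → ℝ

namespace BilinearSystem

variable {n : ℕ} (S : BilinearSystem n)

/-- `F_u = A + B u`. -/
def F (u : ℝ) : Matrix (Fin n) (Fin n) ℝ := S.A + u • S.B

/-- `π(u) = -(A + B u)⁻¹ (b u + E)`. -/
def equil (u : ℝ) : Fin n → ℝ := -((S.F u)⁻¹ *ᵥ (u • S.b + S.E))

/-- `g_u = B π(u) + b`. -/
def g (u : ℝ) : Fin n → ℝ := S.B *ᵥ S.equil u + S.b

/-- The row vector `M = C F_u⁻¹`. -/
def M (u : ℝ) : Fin n → ℝ := S.C ᵥ* (S.F u)⁻¹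

/-- The forwarding feedback
`φ(x,z) = -(B(x-x_ss)+g)ᵀ [k_p (x-x_ss)ᵀ P - k_i (z - M (x-x_ss)) M]ᵀ`. -/
def forwardingFeedback (P : Matrix (Fin n) (Fin n) ℝ) (kp ki uss : ℝ) (xss : Fin n → ℝ)
    (x : Fin n → ℝ) (z : ℝ) : ℝ :=
  -((S.B *ᵥ (x - xss) + S.g uss) ⬝ᵥ
    (kp • ((x - xss) ᵥ* P) - (ki * (z - S.M uss ⬝ᵥ (x - xss))) • S.M uss))

/-- The plant with integrator `z' = e`, as a vector field on `(x,z)`, in closed loop with the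
feedback `u = u_ss + φ(x,z)`. -/
def closedLoop (lo hi r uss : ℝ) (φ : (Fin n → ℝ) → ℝ → ℝ) (ξ : (Fin n → ℝ) × ℝ) :
    (Fin n → ℝ) × ℝ :=
  (S.A *ᵥ ξ.1 + sat lo hi (uss + φ ξ.1 ξ.2) • (S.B *ᵥ ξ.1 + S.b) + S.E,
    S.C ⬝ᵥ ξ.1 - r)

end BilinearSystem

section Stability

variable {X : Type*} [NormedAddCommGroup X] [NormedSpace ℝ X]

/-- `ξ` solves `ξ' = f(ξ)` on `[0,∞)` (its values at negative times are irrelevant). -/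
def IsForwardSolution (f : X → X) (ξ : ℝ → X) : Prop :=
  ∀ t, 0 ≤ t → HasDerivWithinAt ξ (f (ξ t)) (Set.Ici 0) t

/-- Global asymptotic stability of the equilibrium `p` of `ξ' = f(ξ)`: global existence of
solutions forward in time, Lyapunov stability and global attractivity. In finite dimension this
does not depend on the choice of the norm. -/
structure IsGloballyAsymptoticallyStable (f : X → X) (p : X) : Prop where
  equilibrium : f p = 0
  complete : ∀ ξ₀, ∃ ξ : ℝ → X, ξ 0 = ξ₀ ∧ IsForwardSolution f ξ
  stable : ∀ ε > 0, ∃ δ > 0, ∀ ξ : ℝ → X, IsForwardSolution f ξ →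
    ‖ξ 0 - p‖ < δ → ∀ t, 0 ≤ t → ‖ξ t - p‖ < ε
  attractive : ∀ ξ : ℝ → X, IsForwardSolution f ξ → Filter.Tendsto ξ Filter.atTop (nhds p)

/-- Local exponential stability of the equilibrium `p` of `ξ' = f(ξ)`. In finite dimension this
does not depend on the choice of the norm. -/
def IsLocallyExponentiallyStable (f : X → X) (p : X) : Prop :=
  f p = 0 ∧ ∃ δ > 0, ∃ c > 0, ∃ lam > 0,
    (∀ ξ₀, ‖ξ₀ - p‖ < δ → ∃ ξ : ℝ → X, ξ 0 = ξ₀ ∧ IsForwardSolution f ξ) ∧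
    ∀ ξ : ℝ → X, IsForwardSolution f ξ → ‖ξ 0 - p‖ < δ →
      ∀ t, 0 ≤ t → ‖ξ t - p‖ ≤ c * Real.exp (-lam * t) * ‖ξ 0 - p‖

end Stability

end

/-! Write `h = x - x_ss`, `s = sat(u) - u_ss` and `V = (k_p/2) hᵀPh + (k_i/2) (z - Mh)²`. In these
coordinates the plant is `h' = F h + s (B h + g)`, `z' = C h`. Since `M F = C`, the drift cancels
from `z - Mh`, which moves only through `s`. The feedback `φ` is minus the derivative of `V` in the
input direction, so the Lyapunov equation gives `V' = -k_p hᵀΥh - s φ` on the whole space.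

As `u_ss` is interior, `s φ > 0` whenever `φ ≠ 0`. If `V' = 0`, then `h = 0` and `φ = 0`; at `h = 0`
one has `φ = k_i z C F⁻¹ g`, so the gain condition forces `z = 0`. Thus `V` is a strict Lyapunov
function, which gives global asymptotic stability. Near the equilibrium the saturation is inactive
and `s φ = φ²`; the linear part of `φ` makes the dissipation quadratic there, hence exponential
decay.

`P` is not assumed symmetric or positive. Both follow from the Lyapunov equation by following
decaying solutions of `y' = F y`, which are built on generalized eigenspaces. -/

open scoped Matrix

noncomputable section

/-! ### Forward completeness and Lyapunov's direct method -/

section Stability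

variable {X : Type*} [NormedAddCommGroup X] [NormedSpace ℝ X]

/-- A bounded locally Lipschitz vector field is forward complete. -/
theorem exists_isForwardSolution_of_bounded [FiniteDimensional ℝ X] {f : X → X}
    (hf : LocallyLipschitz f) {L : ℝ} (hL : ∀ x, ‖f x‖ ≤ L) (ξ₀ : X) :
    ∃ ξ : ℝ → X, ξ 0 = ξ₀ ∧ IsForwardSolution f ξ := by
  have : ProperSpace X := FiniteDimensional.proper ℝ X
  have hex : ∀ N : ℕ, ∃ ξ : ℝ → X, ξ 0 = ξ₀ ∧
      ∀ t ∈ Set.Icc (0 : ℝ) N, HasDerivWithinAt ξ (f (ξ t)) (Set.Icc 0 N) t := by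
    intro N
    -- At speed at most `L`, a solution cannot leave this ball before time `N`.
    obtain ⟨K, hK⟩ := (hf.locallyLipschitzOn (s := Metric.closedBall ξ₀
      ((L.toNNReal * N : NNReal) : ℝ))).exists_lipschitzOnWith_of_compact
        (isCompact_closedBall _ _)
    have hPL : IsPicardLindelof (fun _ => f) (tmin := 0) (tmax := (N : ℝ))
        ⟨0, by simp⟩ ξ₀ (L.toNNReal * N) 0 L.toNNReal K :=
      { lipschitzOnWith := fun _ _ => hK
        continuousOn := fun _ _ => continuousOn_const
        norm_le := fun _ _ x _ => (hL x).trans (Real.le_coe_toNNReal L)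
        mul_max_le := by simp }
    exact hPL.exists_eq_forall_mem_Icc_hasDerivWithinAt₀
  choose ξ h0 hξ using hex
  have huniq : ∀ M N : ℕ, M ≤ N → Set.EqOn (ξ M) (ξ N) (Set.Icc 0 M) := by
    intro M N hMN
    have hMN' : (M : ℝ) ≤ N := by exact_mod_cast hMN
    have hsub : Set.Icc (0 : ℝ) M ⊆ Set.Icc 0 N := Set.Icc_subset_Icc_right hMN'
    have hcM : ContinuousOn (ξ M) (Set.Icc 0 M) := fun t ht => (hξ M t ht).continuousWithinAt
    have hcN : ContinuousOn (ξ N) (Set.Icc 0 M) := fun t ht =>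
      ((hξ N t (hsub ht)).continuousWithinAt).mono hsub
    obtain ⟨K, hK⟩ := (hf.locallyLipschitzOn
      (s := ξ M '' Set.Icc 0 M ∪ ξ N '' Set.Icc 0 M)).exists_lipschitzOnWith_of_compact
        ((isCompact_Icc.image_of_continuousOn hcM).union (isCompact_Icc.image_of_continuousOn hcN))
    have hd : ∀ (k : ℕ), M ≤ k → ∀ t ∈ Set.Ico (0 : ℝ) M,
        HasDerivWithinAt (ξ k) (f (ξ k t)) (Set.Ici t) t := by
      intro k hk t ht
      have hk' : (M : ℝ) ≤ k := by exact_mod_cast hk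
      refine (hξ k t ⟨ht.1, ht.2.le.trans hk'⟩).mono_of_mem_nhdsWithin ?_
      exact Filter.mem_of_superset (Icc_mem_nhdsGE (ht.2.trans_le hk'))
        (Set.Icc_subset_Icc_left ht.1)
    exact ODE_solution_unique_of_mem_Icc_right (v := fun _ => f) (K := K)
      (s := fun _ => ξ M '' Set.Icc 0 M ∪ ξ N '' Set.Icc 0 M) (fun _ _ => hK) hcM (hd M le_rfl)
      (fun t ht => Or.inl ⟨t, Set.Ico_subset_Icc_self ht, rfl⟩) hcN (hd N hMN)
      (fun t ht => Or.inr ⟨t, Set.Ico_subset_Icc_self ht, rfl⟩) (by rw [h0, h0])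
  have heq : ∀ (N : ℕ) (t : ℝ), t ∈ Set.Icc (0 : ℝ) N → ξ (⌈t⌉₊ + 1) t = ξ N t := by
    intro N t ht
    have ht' : t ∈ Set.Icc (0 : ℝ) (⌈t⌉₊ + 1 : ℕ) :=
      ⟨ht.1, (Nat.le_ceil t).trans (by push_cast; linarith)⟩
    rcases le_total (⌈t⌉₊ + 1) N with h | h
    · exact huniq _ _ h ht'
    · exact (huniq _ _ h ht).symm
  -- The `+ 1` keeps `t` strictly below the horizon, so that `[0, N]` is a neighbourhood of `t`
  -- within `[0, ∞)`.
  refine ⟨fun t => ξ (⌈t⌉₊ + 1) t, h0 _, fun t ht => ?_⟩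
  set N := ⌈t⌉₊ + 1 with hN
  have htN : t < (N : ℝ) := (Nat.le_ceil t).trans_lt (by rw [hN]; push_cast; linarith)
  have h1 : HasDerivWithinAt (fun t => ξ (⌈t⌉₊ + 1) t) (f (ξ N t)) (Set.Icc 0 N) t :=
    (hξ N t ⟨ht, htN.le⟩).congr (fun s hs => heq N s hs) (heq N t ⟨ht, htN.le⟩)
  refine h1.mono_of_mem_nhdsWithin ?_
  rw [← Set.Ici_inter_Iic]
  exact Filter.inter_mem self_mem_nhdsWithin (mem_nhdsWithin_of_mem_nhds (Iic_mem_nhds htN))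

/-- A differentiable function whose derivative along the vector field is nonpositive does not
increase along forward solutions. -/
theorem IsForwardSolution.antitoneOn_comp {f : X → X} {ξ : ℝ → X} (hξ : IsForwardSolution f ξ)
    {V : X → ℝ} {V' : X → X →L[ℝ] ℝ} (hV : ∀ x, HasFDerivAt V (V' x) x)
    (hdec : ∀ x, V' x (f x) ≤ 0) : AntitoneOn (fun t => V (ξ t)) (Set.Ici 0) := by
  have hd : ∀ t ∈ Set.Ici (0 : ℝ),
      HasDerivWithinAt (fun t => V (ξ t)) (V' (ξ t) (f (ξ t))) (Set.Ici 0) t := fun t ht =>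
    (hV (ξ t)).comp_hasDerivWithinAt t (hξ t ht)
  refine antitoneOn_of_hasDerivWithinAt_nonpos (convex_Ici 0)
    (fun t ht => (hd t ht).continuousWithinAt)
    (fun t ht => (hd t (interior_subset ht)).mono interior_subset) (fun t _ => hdec _)

/-- A locally Lipschitz vector field with a radially unbounded weak Lyapunov function is forward
complete. -/
theorem exists_isForwardSolution_of_lyapunov [FiniteDimensional ℝ X] {f : X → X}
    (hf : LocallyLipschitz f) {V : X → ℝ} {V' : X → X →L[ℝ] ℝ}
    (hV : ∀ x, HasFDerivAt V (V' x) x) (hdec : ∀ x, V' x (f x) ≤ 0)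
    (hbdd : ∀ c, Bornology.IsBounded {x | V x ≤ c}) (ξ₀ : X) :
    ∃ ξ : ℝ → X, ξ 0 = ξ₀ ∧ IsForwardSolution f ξ := by
  have : ProperSpace X := FiniteDimensional.proper ℝ X
  obtain ⟨R, hR, hball⟩ := (hbdd (V ξ₀)).subset_closedBall_lt 0 0
  -- The truncated field `χ • f` is bounded and still does not increase `V`. Its solution therefore
  -- stays in the initial sublevel set, where `χ = 1`, and so solves the original equation.
  let χ : ContDiffBump (0 : X) := ⟨R, R + 1, hR, by linarith⟩
  have hχ : LocallyLipschitz χ := (χ.contDiff (n := 1)).locallyLipschitz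
  have hsmul : LocallyLipschitz fun q : ℝ × X => q.1 • q.2 :=
    (contDiff_fst.smul contDiff_snd : ContDiff ℝ 1 fun q : ℝ × X => q.1 • q.2).locallyLipschitz
  have hcut : LocallyLipschitz fun x => χ x • f x := hsmul.comp (hχ.prodMk hf)
  obtain ⟨L, hL⟩ := (isCompact_closedBall (0 : X) (R + 1)).exists_bound_of_continuousOn
    hcut.continuous.continuousOn
  have hL0 : 0 ≤ L := (norm_nonneg _).trans (hL 0 (by simp; linarith))
  obtain ⟨ξ, h0, hξ⟩ := exists_isForwardSolution_of_bounded hcut (L := L) (fun x => by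
    by_cases hx : x ∈ Metric.closedBall (0 : X) (R + 1)
    · exact hL x hx
    · have hx' : R + 1 < dist x 0 := by simpa only [Metric.mem_closedBall, not_le] using hx
      have : χ x = 0 := χ.zero_of_le_dist hx'.le
      simpa [this] using hL0) ξ₀
  have hanti := hξ.antitoneOn_comp hV (fun x => by
    simpa using mul_nonpos_of_nonneg_of_nonpos χ.nonneg (hdec x))
  refine ⟨ξ, h0, fun t ht => ?_⟩
  have hmem : ξ t ∈ Metric.closedBall (0 : X) R := by
    apply hball
    have := hanti (Set.mem_Ici.2 le_rfl) (Set.mem_Ici.2 ht) ht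
    simpa [h0] using this
  have h1 : χ (ξ t) = 1 := χ.one_of_mem_closedBall hmem
  simpa [h1] using hξ t ht

/-- A continuous homogeneous function of degree two is bounded by a multiple of `‖x‖ ^ 2`. -/
theorem exists_abs_le_mul_norm_sq [FiniteDimensional ℝ X] {Q : X → ℝ} (hQ : Continuous Q)
    (hom : ∀ (t : ℝ) (x : X), Q (t • x) = t ^ 2 * Q x) :
    ∃ K > 0, ∀ x, |Q x| ≤ K * ‖x‖ ^ 2 := by
  have : ProperSpace X := FiniteDimensional.proper ℝ X
  obtain ⟨K, hK⟩ := (isCompact_sphere (0 : X) 1).exists_bound_of_continuousOn hQ.continuousOn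
  refine ⟨max K 1, by positivity, fun x => ?_⟩
  by_cases hx : x = 0
  · have hQ0 : Q 0 = 0 := by simpa using hom 0 0
    simp [hx, hQ0]
  have hn : ‖x‖ ≠ 0 := norm_ne_zero_iff.2 hx
  have hu := hK (‖x‖⁻¹ • x) (by simp [norm_smul, hn])
  have hxe : Q x = ‖x‖ ^ 2 * Q (‖x‖⁻¹ • x) := by rw [hom]; field_simp
  rw [hxe, abs_mul, abs_of_nonneg (sq_nonneg ‖x‖), mul_comm]
  exact mul_le_mul_of_nonneg_right (hu.trans (le_max_left _ _)) (sq_nonneg _)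

/-- A positive continuous homogeneous function of degree two dominates a multiple of
`‖x‖ ^ 2`. -/
theorem exists_mul_norm_sq_le [FiniteDimensional ℝ X] {Q : X → ℝ} (hQ : Continuous Q)
    (hom : ∀ (t : ℝ) (x : X), Q (t • x) = t ^ 2 * Q x) (hpos : ∀ x ≠ 0, 0 < Q x) :
    ∃ a > 0, ∀ x, a * ‖x‖ ^ 2 ≤ Q x := by
  have : ProperSpace X := FiniteDimensional.proper ℝ X
  have hQ0 : Q 0 = 0 := by simpa using hom 0 0
  obtain hX | hX := subsingleton_or_nontrivial X
  · exact ⟨1, one_pos, fun x => by simp [Subsingleton.elim x 0, hQ0]⟩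
  obtain ⟨y, hy, hmin⟩ := (isCompact_sphere (0 : X) 1).exists_isMinOn
    (NormedSpace.sphere_nonempty.2 zero_le_one) hQ.continuousOn
  have hy0 : y ≠ 0 := by
    rintro rfl
    simp at hy
  refine ⟨Q y, hpos y hy0, fun x => ?_⟩
  by_cases hx : x = 0
  · simp [hx, hQ0]
  have hn : ‖x‖ ≠ 0 := norm_ne_zero_iff.2 hx
  have hu : Q y ≤ Q (‖x‖⁻¹ • x) := hmin (by simp [norm_smul, hn])
  have hxe : Q x = ‖x‖ ^ 2 * Q (‖x‖⁻¹ • x) := by rw [hom]; field_simp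
  rw [hxe, mul_comm]
  exact mul_le_mul_of_nonneg_left hu (sq_nonneg _)

/-- Lyapunov's direct method with a strict, quadratically bounded Lyapunov function. -/
theorem isGloballyAsymptoticallyStable_of_lyapunov [FiniteDimensional ℝ X] {f : X → X} {p : X}
    (hf : LocallyLipschitz f) (hp : f p = 0) {V W : X → ℝ} {V' : X → X →L[ℝ] ℝ}
    (hV : ∀ x, HasFDerivAt V (V' x) x) {a b : ℝ} (ha : 0 < a) (hb : 0 < b)
    (hlow : ∀ x, a * ‖x - p‖ ^ 2 ≤ V x) (hup : ∀ x, V x ≤ b * ‖x - p‖ ^ 2)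
    (hW : Continuous W) (hWp : W p = 0) (hWpos : ∀ x ≠ p, 0 < W x)
    (hdec : ∀ x, V' x (f x) = -W x) :
    IsGloballyAsymptoticallyStable f p := by
  have : ProperSpace X := FiniteDimensional.proper ℝ X
  have hVc : Continuous V := continuous_iff_continuousAt.2 fun x => (hV x).continuousAt
  have hdec0 : ∀ x, V' x (f x) ≤ 0 := fun x => by
    rw [hdec, neg_nonpos]
    by_cases hx : x = p
    · rw [hx, hWp]
    · exact (hWpos x hx).le
  have hbdd : ∀ c, Bornology.IsBounded {x | V x ≤ c} := by
    intro c
    refine (Metric.isBounded_closedBall (x := p) (r := c / a + 1)).subset fun x hx => ?_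
    rw [Metric.mem_closedBall, dist_eq_norm]
    have h1 : ‖x - p‖ ^ 2 ≤ c / a := by
      rw [le_div_iff₀ ha, mul_comm]
      exact (hlow x).trans hx
    nlinarith [sq_nonneg (‖x - p‖ - 1), norm_nonneg (x - p)]
  have hV0 : ∀ x, 0 ≤ V x := fun x => (by positivity : (0:ℝ) ≤ a * ‖x - p‖ ^ 2).trans (hlow x)
  refine ⟨hp, exists_isForwardSolution_of_lyapunov hf hV hdec0 hbdd, fun ε hε => ?_,
    fun ξ hξ => ?_⟩
  -- This radius `δ` satisfies `b δ² = a ε²`.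
  · refine ⟨ε * √(a / b), by positivity, fun ξ hξ h0 t ht => ?_⟩
    have hanti : V (ξ t) ≤ V (ξ 0) :=
      hξ.antitoneOn_comp hV hdec0 (Set.mem_Ici.2 le_rfl) (Set.mem_Ici.2 ht) ht
    have h1 : ‖ξ 0 - p‖ ^ 2 < ε ^ 2 * (a / b) := by
      rw [← Real.sq_sqrt (by positivity : 0 ≤ a / b), ← mul_pow]
      exact pow_lt_pow_left₀ h0 (norm_nonneg _) two_ne_zero
    have h2 : b * ‖ξ 0 - p‖ ^ 2 < a * ε ^ 2 := by
      calc b * ‖ξ 0 - p‖ ^ 2 < b * (ε ^ 2 * (a / b)) := by gcongr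
        _ = a * ε ^ 2 := by field_simp
    have h3 : a * ‖ξ t - p‖ ^ 2 < a * ε ^ 2 :=
      ((hlow _).trans hanti).trans_lt ((hup _).trans_lt h2)
    exact lt_of_pow_lt_pow_left₀ 2 hε.le (lt_of_mul_lt_mul_left h3 ha.le)
  · have hanti := hξ.antitoneOn_comp hV hdec0
    have hsmall : ∀ ε > 0, ∃ T ≥ 0, V (ξ T) < ε := by
      intro ε hε
      -- Otherwise the solution stays in a compact shell that misses `p`, where `W` has a positive
      -- minimum. Then `V` falls at least linearly and is nonpositive by time `V (ξ 0) / W y`.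
      by_contra! hcon
      have hK : IsCompact {x | ε ≤ V x ∧ V x ≤ V (ξ 0)} :=
        Metric.isCompact_of_isClosed_isBounded
          ((isClosed_le continuous_const hVc).inter (isClosed_le hVc continuous_const))
          ((hbdd (V (ξ 0))).subset fun x hx => hx.2)
      have hmem : ∀ t, 0 ≤ t → ξ t ∈ {x | ε ≤ V x ∧ V x ≤ V (ξ 0)} := fun t ht =>
        ⟨hcon t ht, hanti (Set.mem_Ici.2 le_rfl) (Set.mem_Ici.2 ht) ht⟩
      obtain ⟨y, hy, hmin⟩ := hK.exists_isMinOn ⟨ξ 0, hmem 0 le_rfl⟩ hW.continuousOn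
      have hyp : y ≠ p := by
        rintro rfl
        have h1 := hup y
        simp only [sub_self, norm_zero] at h1
        have h2 : ε ≤ V y := hy.1
        nlinarith
      have hm := hWpos y hyp
      have hd : ∀ t ∈ Set.Ici (0 : ℝ), HasDerivWithinAt (fun t => V (ξ t) + W y * t)
          (V' (ξ t) (f (ξ t)) + W y) (Set.Ici 0) t := fun t ht => by
        have h := ((hV (ξ t)).comp_hasDerivWithinAt t (hξ t ht)).add
          ((hasDerivWithinAt_id t _).const_mul (W y))
        rwa [mul_one] at h
      have hanti2 : AntitoneOn (fun t => V (ξ t) + W y * t) (Set.Ici 0) := by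
        refine antitoneOn_of_hasDerivWithinAt_nonpos (convex_Ici 0)
          (fun t ht => (hd t ht).continuousWithinAt)
          (fun t ht => (hd t (interior_subset ht)).mono interior_subset) (fun t ht => ?_)
        rw [hdec]
        have : W y ≤ W (ξ t) := hmin (hmem t (interior_subset ht))
        linarith
      have hT : 0 ≤ V (ξ 0) / W y := div_nonneg (hV0 _) hm.le
      have h3 := hanti2 (Set.mem_Ici.2 le_rfl) (Set.mem_Ici.2 hT) hT
      have h4 := hcon _ hT
      have h5 : W y * (V (ξ 0) / W y) = V (ξ 0) := by field_simp
      simp only [h5, mul_zero, add_zero] at h3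
      linarith
    rw [Metric.tendsto_atTop]
    intro ε hε
    obtain ⟨T, hT, hVT⟩ := hsmall (a * ε ^ 2) (by positivity)
    refine ⟨T, fun t ht => ?_⟩
    rw [dist_eq_norm]
    have h1 : V (ξ t) ≤ V (ξ T) := hanti (Set.mem_Ici.2 hT) (Set.mem_Ici.2 (hT.trans ht)) ht
    exact lt_of_pow_lt_pow_left₀ 2 hε.le
      (lt_of_mul_lt_mul_left ((hlow _).trans_lt (h1.trans_lt hVT)) ha.le)

/-- Lyapunov's direct method: a quadratically bounded Lyapunov function with a locally quadratic
decay rate yields exponential convergence. -/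
theorem IsGloballyAsymptoticallyStable.isLocallyExponentiallyStable {f : X → X} {p : X}
    (hs : IsGloballyAsymptoticallyStable f p) {V : X → ℝ} {V' : X → X →L[ℝ] ℝ}
    (hV : ∀ x, HasFDerivAt V (V' x) x) {a b c ρ : ℝ} (ha : 0 < a) (hb : 0 < b) (hc : 0 < c)
    (hρ : 0 < ρ) (hlow : ∀ x, a * ‖x - p‖ ^ 2 ≤ V x) (hup : ∀ x, V x ≤ b * ‖x - p‖ ^ 2)
    (hdec : ∀ x, ‖x - p‖ < ρ → V' x (f x) ≤ -(c * ‖x - p‖ ^ 2)) :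
    IsLocallyExponentiallyStable f p := by
  obtain ⟨δ, hδ, hstay⟩ := hs.stable ρ hρ
  -- Near `p` one has `V' ≤ -(c / b) V`; the norm decays at half that rate because `V` is quadratic
  -- in it.
  refine ⟨hs.equilibrium, δ, hδ, √(b / a), by positivity, c / (2 * b), by positivity,
    fun ξ₀ _ => hs.complete ξ₀, fun ξ hξ h0 t ht => ?_⟩
  set l := c / (2 * b) with hl
  have hlb : 2 * l * b = c := by rw [hl]; field_simp
  have hd : ∀ t ∈ Set.Ici (0 : ℝ), HasDerivWithinAt (fun t => Real.exp (2 * l * t) * V (ξ t))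
      (Real.exp (2 * l * t) * (2 * l) * V (ξ t) + Real.exp (2 * l * t) * V' (ξ t) (f (ξ t)))
      (Set.Ici 0) t := fun t ht => by
    have h1 : HasDerivWithinAt (fun t : ℝ => Real.exp (2 * l * t))
        (Real.exp (2 * l * t) * (2 * l)) (Set.Ici 0) t := by
      simpa using ((hasDerivWithinAt_id t _).const_mul (2 * l)).exp
    exact h1.mul ((hV (ξ t)).comp_hasDerivWithinAt t (hξ t ht))
  have hanti : AntitoneOn (fun t => Real.exp (2 * l * t) * V (ξ t)) (Set.Ici 0) := by
    refine antitoneOn_of_hasDerivWithinAt_nonpos (convex_Ici 0)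
      (fun t ht => (hd t ht).continuousWithinAt)
      (fun t ht => (hd t (interior_subset ht)).mono interior_subset) (fun t ht => ?_)
    have ht0 : 0 ≤ t := interior_subset ht
    have h1 := hdec _ (hstay ξ hξ h0 t ht0)
    have h2 : 2 * l * V (ξ t) ≤ c * ‖ξ t - p‖ ^ 2 := by
      calc 2 * l * V (ξ t) ≤ 2 * l * (b * ‖ξ t - p‖ ^ 2) := by gcongr; exact hup _
        _ = c * ‖ξ t - p‖ ^ 2 := by rw [← mul_assoc, hlb]
    rw [mul_assoc, ← mul_add]
    exact mul_nonpos_of_nonneg_of_nonpos (Real.exp_pos _).le (by linarith)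
  have h1 : Real.exp (2 * l * t) * V (ξ t) ≤ V (ξ 0) := by
    simpa using hanti (Set.mem_Ici.2 le_rfl) (Set.mem_Ici.2 ht) ht
  have h2 : V (ξ t) ≤ Real.exp (-l * t) ^ 2 * V (ξ 0) := by
    have he : Real.exp (-l * t) ^ 2 * Real.exp (2 * l * t) = 1 := by
      rw [← Real.exp_nat_mul, ← Real.exp_add, ← Real.exp_zero]
      congr 1
      push_cast
      ring
    calc V (ξ t) = Real.exp (-l * t) ^ 2 * (Real.exp (2 * l * t) * V (ξ t)) := by
          rw [← mul_assoc, he, one_mul]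
      _ ≤ _ := by gcongr
  refine (pow_le_pow_iff_left₀ (norm_nonneg _) (by positivity) two_ne_zero).1 ?_
  rw [mul_pow, mul_pow, Real.sq_sqrt (by positivity)]
  calc ‖ξ t - p‖ ^ 2 = a * ‖ξ t - p‖ ^ 2 / a := by field_simp
    _ ≤ (Real.exp (-l * t) ^ 2 * (b * ‖ξ 0 - p‖ ^ 2)) / a :=
        div_le_div_of_nonneg_right ((hlow _).trans (h2.trans
          (mul_le_mul_of_nonneg_left (hup _) (by positivity)))) ha.le
    _ = _ := by ring

end Stability

/-! ### Hurwitz matrices and the Lyapunov equation -/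

section Hurwitz

open Filter Topology

/-- If all eigenvalues of `T` have negative real part, every vector is the initial value of a
solution of `y' = T y` that tends to zero. -/
theorem Module.End.exists_hasDerivAt_tendsto_zero {n : ℕ} (T : Module.End ℂ (Fin n → ℂ))
    (hT : ∀ μ, T.HasEigenvalue μ → μ.re < 0) (v : Fin n → ℂ) :
    ∃ y : ℝ → Fin n → ℂ, y 0 = v ∧ (∀ t, HasDerivAt y (T (y t)) t) ∧ Tendsto y atTop (𝓝 0) := by
  -- By superposition the good initial values form a subspace, so it suffices to treat generalized
  -- eigenvectors.
  let S : Submodule ℂ (Fin n → ℂ) :=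
    { carrier := {v | ∃ y : ℝ → Fin n → ℂ, y 0 = v ∧ (∀ t, HasDerivAt y (T (y t)) t) ∧
        Tendsto y atTop (𝓝 0)}
      zero_mem' := ⟨fun _ => 0, rfl, fun t => by simpa using hasDerivAt_const t (0 : Fin n → ℂ),
        tendsto_const_nhds⟩
      add_mem' := by
        rintro _ _ ⟨y, rfl, hy, hy0⟩ ⟨w, rfl, hw, hw0⟩
        refine ⟨y + w, rfl, fun t => ?_,
          by simpa only [add_zero] using! hy0.add hw0⟩
        simpa using (hy t).add (hw t)
      smul_mem' := by
        rintro c _ ⟨y, rfl, hy, hy0⟩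
        refine ⟨c • y, rfl, fun t => ?_,
          by simpa only [smul_zero] using! hy0.const_smul c⟩
        simpa using (hy t).const_smul c }
  suffices h : S = ⊤ by
    have : v ∈ S := h ▸ Submodule.mem_top
    exact this
  rw [eq_top_iff, ← Module.End.iSup_maxGenEigenspace_eq_top T, iSup_le_iff]
  intro μ v hv
  by_cases hev : T.HasEigenvalue μ
  swap
  · have hbot : T.maxGenEigenspace μ = ⊥ := by
      by_contra hne
      obtain ⟨w, hw, hw0⟩ := Submodule.exists_mem_ne_zero_of_ne_bot hne
      obtain ⟨k, hk⟩ := (Module.End.mem_maxGenEigenspace T μ w).1 hw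
      have : T.HasUnifEigenvalue μ k := by
        rw [Module.End.HasUnifEigenvalue]
        intro hb
        have hm : w ∈ T.genEigenspace μ k := by
          rwa [Module.End.mem_genEigenspace_nat, LinearMap.mem_ker]
        rw [hb] at hm
        exact hw0 ((Submodule.mem_bot ℂ).1 hm)
      exact hev (this.lt one_pos)
    rw [hbot, Submodule.mem_bot] at hv
    exact hv ▸ S.zero_mem
  have hμ := hT μ hev
  obtain ⟨m, hm⟩ := (Module.End.mem_maxGenEigenspace T μ v).1 hv
  set N := T - μ • (1 : Module.End ℂ (Fin n → ℂ)) with hN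
  have hTN : ∀ w, T w = μ • w + N w := fun w => by simp [hN]
  -- This is `exp(tN) v`, a finite sum because `N ^ m` kills `v`; multiplying by `exp(μt)` solves
  -- `y' = T y`.
  let p : ℝ → Fin n → ℂ := fun t =>
    ∑ k ∈ Finset.range (m + 1), ((t : ℂ) ^ k / (k.factorial : ℂ)) • (N ^ k) v
  have hp : ∀ t, HasDerivAt p (N (p t)) t := by
    intro t
    have h1 : HasDerivAt p (∑ k ∈ Finset.range (m + 1),
        ((k : ℂ) * (t : ℂ) ^ (k - 1) * 1 / (k.factorial : ℂ)) • (N ^ k) v) t := by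
      refine HasDerivAt.fun_sum fun k _ => ?_
      exact ((((hasDerivAt_id t).ofReal_comp).pow k).div_const _).smul_const _
    convert h1 using 1
    rw [Finset.sum_range_succ', map_sum, Finset.sum_range_succ]
    have hz : N ((N ^ m) v) = 0 := by rw [hm, map_zero]
    simp only [map_smul, hz, smul_zero, add_zero, Nat.cast_zero, zero_mul, zero_div, zero_smul]
    refine Finset.sum_congr rfl fun k _ => ?_
    rw [pow_succ' N k, Module.End.mul_apply]
    congr 1
    have h2 : ((k + 1 : ℕ) : ℂ) ≠ 0 := by exact_mod_cast k.succ_ne_zero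
    have h3 : (k.factorial : ℂ) ≠ 0 := by exact_mod_cast k.factorial_ne_zero
    rw [Nat.factorial_succ]
    push_cast at h2 ⊢
    field_simp
  refine ⟨fun t => Complex.exp (μ * t) • p t, ?_, fun t => ?_, ?_⟩
  · simp only [p, Finset.sum_range_succ']
    simp
  · have he : HasDerivAt (fun t : ℝ => Complex.exp (μ * t)) (Complex.exp (μ * t) * (μ * 1)) t :=
      (((hasDerivAt_id t).ofReal_comp).const_mul μ).cexp
    refine (he.smul (hp t)).congr_deriv ?_
    rw [map_smul, hTN, smul_add, smul_smul, mul_one, add_comm]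
  · have hterm : ∀ k : ℕ, Tendsto (fun t : ℝ => Complex.exp (μ * t) *
        ((t : ℂ) ^ k / (k.factorial : ℂ))) atTop (𝓝 0) := by
      intro k
      rw [tendsto_zero_iff_norm_tendsto_zero]
      have ha : 0 < -μ.re := neg_pos.2 hμ
      have h1 := (Real.tendsto_pow_mul_exp_neg_atTop_nhds_zero k).comp
        (tendsto_id.const_mul_atTop ha)
      have h2 := h1.const_mul (((-μ.re) ^ k)⁻¹ / k.factorial)
      rw [mul_zero] at h2
      refine h2.congr' ?_
      filter_upwards [eventually_ge_atTop 0] with t ht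
      have hak : (-μ.re) ^ k ≠ 0 := (pow_pos ha k).ne'
      simp only [Function.comp, id, norm_mul, Complex.norm_exp, norm_div, norm_pow,
        Complex.norm_real, Real.norm_of_nonneg ht, Complex.norm_natCast, Complex.mul_re,
        Complex.ofReal_re, Complex.ofReal_im, mul_zero, sub_zero, neg_mul, neg_neg]
      rw [← neg_mul, mul_pow]
      field_simp
    have h : Tendsto (fun t : ℝ => ∑ k ∈ Finset.range (m + 1), (Complex.exp (μ * t) *
        ((t : ℂ) ^ k / (k.factorial : ℂ))) • (N ^ k) v) atTop
        (𝓝 (∑ k ∈ Finset.range (m + 1), (0 : ℂ) • (N ^ k) v)) :=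
      tendsto_finsetSum _ fun k _ => (hterm k).smul_const _
    simp only [zero_smul, Finset.sum_const_zero] at h
    refine h.congr fun t => ?_
    simp only [p, Finset.smul_sum, smul_smul]

variable {n : ℕ} {F : Matrix (Fin n) (Fin n) ℝ}

/-- Every vector is the initial value of a decaying solution of `y' = F y` for Hurwitz `F`. -/
theorem IsHurwitz.exists_hasDerivAt_tendsto_zero (hF : IsHurwitz F) (x : Fin n → ℝ) :
    ∃ y : ℝ → Fin n → ℝ, y 0 = x ∧ (∀ t, HasDerivAt y (F *ᵥ y t) t) ∧
      Tendsto y atTop (𝓝 0) := by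
  obtain ⟨y, h0, hy, hlim⟩ := Module.End.exists_hasDerivAt_tendsto_zero
    (Matrix.toLin' (F.map (algebraMap ℝ ℂ)))
    (fun μ hμ => hF μ (by
      rw [← Matrix.spectrum_toLin']
      exact Module.End.hasEigenvalue_iff_mem_spectrum.1 hμ)) (fun i => (x i : ℂ))
  refine ⟨fun t i => (y t i).re, by simp [h0], fun t => ?_, ?_⟩
  · rw [hasDerivAt_pi]
    intro i
    have h1 := Complex.reCLM.hasFDerivAt.comp_hasDerivAt t (hasDerivAt_pi.1 (hy t) i)
    refine h1.congr_deriv ?_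
    simp [Matrix.mulVec, dotProduct]
  · rw [tendsto_pi_nhds] at hlim ⊢
    intro i
    exact (Complex.continuous_re.tendsto' 0 0 rfl).comp (hlim i)

theorem IsHurwitz.isUnit_det (hF : IsHurwitz F) : IsUnit F.det := by
  by_contra h
  have h0 : F.det = 0 := by simpa using h
  have hmem : (0 : ℂ) ∈ spectrum ℂ (F.map (algebraMap ℝ ℂ)) := by
    rw [spectrum.zero_mem_iff, Matrix.isUnit_iff_isUnit_det]
    have : (F.map (algebraMap ℝ ℂ)).det = algebraMap ℝ ℂ F.det :=
      ((algebraMap ℝ ℂ).map_det F).symm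
    rw [this, h0, map_zero]
    exact not_isUnit_zero
  simpa using hF 0 hmem

/-- Derivative of a bilinear form along two curves. -/
theorem hasDerivAt_dotProduct_mulVec {y w : ℝ → Fin n → ℝ} {t : ℝ} {y' w' : Fin n → ℝ}
    (hy : HasDerivAt y y' t) (hw : HasDerivAt w w' t) (P : Matrix (Fin n) (Fin n) ℝ) :
    HasDerivAt (fun t => y t ⬝ᵥ P *ᵥ w t) (y' ⬝ᵥ P *ᵥ w t + y t ⬝ᵥ P *ᵥ w') t := by
  rw [hasDerivAt_pi] at hy hw
  simp only [dotProduct, Matrix.mulVec, ← Finset.sum_add_distrib]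
  refine HasDerivAt.fun_sum fun i _ => (hy i).mul (HasDerivAt.fun_sum fun j _ => ?_)
  exact (hw j).const_mul _

theorem lyapunov_dotProduct {P Q : Matrix (Fin n) (Fin n) ℝ} (hP : Fᵀ * P + P * F = Q)
    (x y : Fin n → ℝ) : (F *ᵥ x) ⬝ᵥ P *ᵥ y + x ⬝ᵥ P *ᵥ (F *ᵥ y) = x ⬝ᵥ Q *ᵥ y := by
  rw [← hP, Matrix.add_mulVec, dotProduct_add, ← Matrix.mulVec_mulVec, ← Matrix.mulVec_mulVec,
    Matrix.dotProduct_mulVec x Fᵀ, Matrix.vecMul_transpose]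

/-- Along two solutions of `y' = F y` the bilinear form of `P` is constant by the equation, yet it
tends to zero because both solutions decay. -/
theorem IsHurwitz.eq_zero_of_lyapunov (hF : IsHurwitz F) {P : Matrix (Fin n) (Fin n) ℝ}
    (hP : Fᵀ * P + P * F = 0) : P = 0 := by
  have key : ∀ x w : Fin n → ℝ, x ⬝ᵥ P *ᵥ w = 0 := by
    intro x w
    obtain ⟨X, hX0, hX, hXlim⟩ := hF.exists_hasDerivAt_tendsto_zero x
    obtain ⟨Y, hY0, hY, hYlim⟩ := hF.exists_hasDerivAt_tendsto_zero w
    have hd : ∀ t, HasDerivAt (fun t => X t ⬝ᵥ P *ᵥ Y t) 0 t := fun t => by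
      have := hasDerivAt_dotProduct_mulVec (hX t) (hY t) P
      rwa [lyapunov_dotProduct hP, Matrix.zero_mulVec, dotProduct_zero] at this
    have hconst : ∀ t, X t ⬝ᵥ P *ᵥ Y t = x ⬝ᵥ P *ᵥ w := fun t => by
      have := is_const_of_deriv_eq_zero (fun t => (hd t).differentiableAt)
        (fun t => (hd t).deriv) t 0
      simpa [hX0, hY0] using this
    have hc : Continuous fun q : (Fin n → ℝ) × (Fin n → ℝ) => q.1 ⬝ᵥ P *ᵥ q.2 := by fun_prop
    have hlim := (hc.tendsto (0, 0)).comp (hXlim.prodMk_nhds hYlim)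
    simp only [zero_dotProduct] at hlim
    refine tendsto_nhds_unique (tendsto_const_nhds.congr fun t => (hconst t).symm) hlim
  refine Matrix.ext_of_mulVec_single fun i => ?_
  rw [Matrix.zero_mulVec]
  exact dotProduct_eq_zero_iff.1 fun w => by rw [dotProduct_comm]; exact key _ _

/-- `Pᵀ` solves the same equation, and the homogeneous equation has only the zero solution. -/
theorem IsHurwitz.transpose_eq_of_lyapunov (hF : IsHurwitz F) {P Q : Matrix (Fin n) (Fin n) ℝ}
    (hP : Fᵀ * P + P * F = Q) (hQ : Qᵀ = Q) : Pᵀ = P := by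
  have h : Fᵀ * Pᵀ + Pᵀ * F = Q := by
    rw [← hQ, ← hP]
    simp [Matrix.transpose_mul, add_comm]
  refine sub_eq_zero.1 (hF.eq_zero_of_lyapunov ?_)
  rw [mul_sub, sub_mul, sub_add_sub_comm, h, hP, sub_self]

/-- Lyapunov's theorem: for Hurwitz `F` the solution of the Lyapunov equation is positive. -/
theorem IsHurwitz.pos_of_lyapunov (hF : IsHurwitz F) {P Q : Matrix (Fin n) (Fin n) ℝ}
    (hP : Fᵀ * P + P * F = Q) (hQ : ∀ x ≠ 0, x ⬝ᵥ Q *ᵥ x < 0) {x : Fin n → ℝ} (hx : x ≠ 0) :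
    0 < x ⬝ᵥ P *ᵥ x := by
  have hd : ∀ {X : ℝ → Fin n → ℝ}, (∀ t, HasDerivAt X (F *ᵥ X t) t) → ∀ t,
      HasDerivAt (fun t => X t ⬝ᵥ P *ᵥ X t) (X t ⬝ᵥ Q *ᵥ X t) t := fun hX t => by
    have := hasDerivAt_dotProduct_mulVec (hX t) (hX t) P
    rwa [lyapunov_dotProduct hP] at this
  -- Along a decaying solution the form is nonincreasing with limit zero.
  have hnonneg : ∀ w : Fin n → ℝ, 0 ≤ w ⬝ᵥ P *ᵥ w := by
    intro w
    obtain ⟨X, hX0, hX, hXlim⟩ := hF.exists_hasDerivAt_tendsto_zero w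
    have hanti : Antitone fun t => X t ⬝ᵥ P *ᵥ X t := by
      refine antitone_of_hasDerivAt_nonpos (hd hX) fun t => ?_
      by_cases h0 : X t = 0
      · simp [h0]
      · exact (hQ _ h0).le
    have hc : Continuous fun q : Fin n → ℝ => q ⬝ᵥ P *ᵥ q := by fun_prop
    have hlim := (hc.tendsto 0).comp hXlim
    simp only [zero_dotProduct] at hlim
    have := hanti.le_of_tendsto hlim 0
    simpa [hX0] using this
  -- A zero value would be a minimum along the two-sided solution through `x`, although the
  -- derivative there is `xᵀQx < 0`.
  refine (hnonneg x).lt_of_ne fun h => ?_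
  obtain ⟨X, hX0, hX, -⟩ := hF.exists_hasDerivAt_tendsto_zero x
  have hmin : IsLocalMin (fun t => X t ⬝ᵥ P *ᵥ X t) 0 := by
    refine Filter.Eventually.of_forall fun t => ?_
    simpa [hX0, ← h] using hnonneg (X t)
  have := hmin.hasDerivAt_eq_zero (hd hX 0)
  rw [hX0] at this
  exact (hQ x hx).ne this

end Hurwitz

/-! ### Sector property of the saturation -/

section Saturation

variable {lo hi u s : ℝ}

theorem continuous_sat : Continuous (sat lo hi) := by
  unfold sat
  fun_prop

theorem locallyLipschitz_sat : LocallyLipschitz (sat lo hi) :=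
  (LocallyLipschitz.id.const_min hi).const_max lo

/-- With `u` strictly between the levels, even a clipped value lies strictly on the side of `u` to
which `s` points. -/
theorem sat_sub_mul_pos (hu : u ∈ Set.Ioo lo hi) (hs : s ≠ 0) :
    0 < (sat lo hi (u + s) - u) * s := by
  rcases hs.lt_or_gt with h | h
  · refine mul_pos_of_neg_of_neg (sub_neg.2 ?_) h
    exact max_lt hu.1 ((min_le_right _ _).trans_lt (by linarith))
  · refine mul_pos (sub_pos.2 ?_) h
    exact (lt_min hu.2 (by linarith)).trans_le (le_max_right _ _)

theorem sat_sub_mul_nonneg (hu : u ∈ Set.Ioo lo hi) : 0 ≤ (sat lo hi (u + s) - u) * s := by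
  by_cases hs : s = 0
  · simp [hs]
  · exact (sat_sub_mul_pos hu hs).le

end Saturation

/-! ### Smoothness of matrix expressions -/

section Smoothness

variable {n : ℕ} {Y : Type*} [NormedAddCommGroup Y] [NormedSpace ℝ Y] {k : WithTop ℕ∞}

theorem ContDiff.matrix_mulVec {v : Y → Fin n → ℝ} (hv : ContDiff ℝ k v)
    (A : Matrix (Fin n) (Fin n) ℝ) : ContDiff ℝ k fun y => A *ᵥ v y := by
  rw [contDiff_pi] at hv ⊢
  intro i
  simp only [Matrix.mulVec, dotProduct]
  exact ContDiff.sum fun j _ => contDiff_const.mul (hv j)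

theorem ContDiff.dotProduct {v w : Y → Fin n → ℝ} (hv : ContDiff ℝ k v) (hw : ContDiff ℝ k w) :
    ContDiff ℝ k fun y => v y ⬝ᵥ w y := by
  rw [contDiff_pi] at hv hw
  simp only [_root_.dotProduct]
  exact ContDiff.sum fun j _ => (hv j).mul (hw j)

end Smoothness

/-! ### The forwarding feedback and its Lyapunov function -/

namespace BilinearSystem

variable {n : ℕ} (S : BilinearSystem n)

/-- The gradient factor of the forwarding feedback, as a function of the error `(x - x_ss, z)`. -/
def gradientFactor (P : Matrix (Fin n) (Fin n) ℝ) (kp ki u : ℝ) (h : (Fin n → ℝ) × ℝ) :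
    Fin n → ℝ :=
  kp • (h.1 ᵥ* P) - (ki * (h.2 - S.M u ⬝ᵥ h.1)) • S.M u

/-- The forwarding Lyapunov function, as a function of the error `(x - x_ss, z)`. -/
def lyapunovForm (P : Matrix (Fin n) (Fin n) ℝ) (kp ki u : ℝ) (h : (Fin n → ℝ) × ℝ) : ℝ :=
  kp / 2 * (h.1 ⬝ᵥ P *ᵥ h.1) + ki / 2 * (h.2 - S.M u ⬝ᵥ h.1) ^ 2

/-- The part of the forwarding feedback that is linear in the error. -/
def linearFeedback (P : Matrix (Fin n) (Fin n) ℝ) (kp ki u : ℝ) (h : (Fin n → ℝ) × ℝ) : ℝ :=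
  -(S.g u ⬝ᵥ S.gradientFactor P kp ki u h)

/-- The part of the forwarding feedback that is quadratic in the error. -/
def quadraticFeedback (P : Matrix (Fin n) (Fin n) ℝ) (kp ki u : ℝ) (h : (Fin n → ℝ) × ℝ) : ℝ :=
  -((S.B *ᵥ h.1) ⬝ᵥ S.gradientFactor P kp ki u h)

variable (P : Matrix (Fin n) (Fin n) ℝ) (kp ki u : ℝ)

theorem forwardingFeedback_eq (xss x : Fin n → ℝ) (z : ℝ) :
    S.forwardingFeedback P kp ki u xss x z =
      S.linearFeedback P kp ki u (x - xss, z) + S.quadraticFeedback P kp ki u (x - xss, z) := by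
  simp only [forwardingFeedback, linearFeedback, quadraticFeedback, gradientFactor,
    add_dotProduct]
  ring

theorem contDiff_gradientFactor {k : WithTop ℕ∞} :
    ContDiff ℝ k (S.gradientFactor P kp ki u) := by
  unfold gradientFactor
  simp only [← Matrix.mulVec_transpose P]
  exact ((contDiff_fst.matrix_mulVec _).const_smul kp).sub
    ((contDiff_const.mul (contDiff_snd.sub (contDiff_const.dotProduct contDiff_fst))).smul
      contDiff_const)

theorem contDiff_linearFeedback {k : WithTop ℕ∞} : ContDiff ℝ k (S.linearFeedback P kp ki u) :=
  (contDiff_const.dotProduct (S.contDiff_gradientFactor P kp ki u)).neg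

theorem contDiff_quadraticFeedback {k : WithTop ℕ∞} :
    ContDiff ℝ k (S.quadraticFeedback P kp ki u) :=
  ((contDiff_fst.matrix_mulVec S.B).dotProduct (S.contDiff_gradientFactor P kp ki u)).neg

theorem contDiff_lyapunovForm {k : WithTop ℕ∞} : ContDiff ℝ k (S.lyapunovForm P kp ki u) :=
  (contDiff_const.mul (contDiff_fst.dotProduct (contDiff_fst.matrix_mulVec P))).add
    (contDiff_const.mul ((contDiff_snd.sub (contDiff_const.dotProduct contDiff_fst)).pow 2))

theorem contDiff_forwardingFeedback {k : WithTop ℕ∞} (xss : Fin n → ℝ) :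
    ContDiff ℝ k fun ξ : (Fin n → ℝ) × ℝ => S.forwardingFeedback P kp ki u xss ξ.1 ξ.2 := by
  simp only [forwardingFeedback_eq]
  have h : ContDiff ℝ k fun ξ : (Fin n → ℝ) × ℝ => (ξ.1 - xss, ξ.2) :=
    (contDiff_fst.sub contDiff_const).prodMk contDiff_snd
  exact ((S.contDiff_linearFeedback P kp ki u).comp h).add
    ((S.contDiff_quadraticFeedback P kp ki u).comp h)

/-- The saturation is not smooth, so the state equation is split into a smooth map of state and
applied input, composed with the locally Lipschitz input. -/
theorem locallyLipschitz_closedLoop (lo hi r : ℝ) (xss : Fin n → ℝ) :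
    LocallyLipschitz (S.closedLoop lo hi r u (S.forwardingFeedback P kp ki u xss)) := by
  have hf : ContDiff ℝ 1 fun q : ((Fin n → ℝ) × ℝ) × ℝ => q.1.1 := by fun_prop
  have h1 : ContDiff ℝ 1 fun q : ((Fin n → ℝ) × ℝ) × ℝ =>
      S.A *ᵥ q.1.1 + q.2 • (S.B *ᵥ q.1.1 + S.b) + S.E :=
    ((hf.matrix_mulVec S.A).add
      (contDiff_snd.smul ((hf.matrix_mulVec S.B).add contDiff_const))).add contDiff_const
  have h2 : ContDiff ℝ 1 fun ξ : (Fin n → ℝ) × ℝ => S.C ⬝ᵥ ξ.1 - r :=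
    (contDiff_const.dotProduct contDiff_fst).sub contDiff_const
  have h3 : ContDiff ℝ 1 fun ξ : (Fin n → ℝ) × ℝ =>
      u + S.forwardingFeedback P kp ki u xss ξ.1 ξ.2 :=
    contDiff_const.add (S.contDiff_forwardingFeedback P kp ki u xss)
  have h4 := h1.locallyLipschitz.comp
    (LocallyLipschitz.id.prodMk (locallyLipschitz_sat (lo := lo) (hi := hi) |>.comp
      h3.locallyLipschitz))
  exact h4.prodMk h2.locallyLipschitz

theorem gradientFactor_smul (t : ℝ) (h : (Fin n → ℝ) × ℝ) :
    S.gradientFactor P kp ki u (t • h) = t • S.gradientFactor P kp ki u h := by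
  ext i
  simp only [gradientFactor, Prod.smul_fst, Prod.smul_snd, Matrix.smul_vecMul, dotProduct_smul,
    smul_eq_mul, Pi.sub_apply, Pi.smul_apply]
  ring

theorem linearFeedback_smul (t : ℝ) (h : (Fin n → ℝ) × ℝ) :
    S.linearFeedback P kp ki u (t • h) = t * S.linearFeedback P kp ki u h := by
  simp [linearFeedback, gradientFactor_smul]

theorem quadraticFeedback_smul (t : ℝ) (h : (Fin n → ℝ) × ℝ) :
    S.quadraticFeedback P kp ki u (t • h) = t ^ 2 * S.quadraticFeedback P kp ki u h := by
  simp only [quadraticFeedback, gradientFactor_smul, Prod.smul_fst, Matrix.mulVec_smul,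
    smul_dotProduct, dotProduct_smul, smul_eq_mul]
  ring

theorem lyapunovForm_smul (t : ℝ) (h : (Fin n → ℝ) × ℝ) :
    S.lyapunovForm P kp ki u (t • h) = t ^ 2 * S.lyapunovForm P kp ki u h := by
  simp only [lyapunovForm, Prod.smul_fst, Prod.smul_snd, Matrix.mulVec_smul,
    smul_dotProduct, dotProduct_smul, smul_eq_mul]
  ring

variable {P kp ki u}

theorem lyapunovForm_pos (hkp : 0 < kp) (hki : 0 < ki) (hP : ∀ x ≠ 0, 0 < x ⬝ᵥ P *ᵥ x)
    {h : (Fin n → ℝ) × ℝ} (h0 : h ≠ 0) : 0 < S.lyapunovForm P kp ki u h := by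
  by_cases h1 : h.1 = 0
  · have h2 : h.2 ≠ 0 := fun h2 => h0 (Prod.ext h1 h2)
    simp only [lyapunovForm, h1, zero_dotProduct, dotProduct_zero, mul_zero, zero_add, sub_zero]
    positivity
  · have := hP _ h1
    unfold lyapunovForm
    positivity

/-- At zero state error, the linear part of the feedback is a nonzero multiple of the integrator
state. -/
theorem linearFeedback_of_fst_eq_zero {h : (Fin n → ℝ) × ℝ} (h1 : h.1 = 0) :
    S.linearFeedback P kp ki u h = ki * h.2 * (S.C ⬝ᵥ ((S.F u)⁻¹ *ᵥ S.g u)) := by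
  simp only [linearFeedback, gradientFactor, h1, Matrix.zero_vecMul, smul_zero, dotProduct_zero,
    sub_zero, zero_sub, dotProduct_neg, neg_neg, dotProduct_smul, smul_eq_mul]
  rw [dotProduct_comm, M, Matrix.dotProduct_mulVec]

theorem quadraticFeedback_of_fst_eq_zero {h : (Fin n → ℝ) × ℝ} (h1 : h.1 = 0) :
    S.quadraticFeedback P kp ki u h = 0 := by
  simp [quadraticFeedback, h1]

theorem fderiv_lyapunovForm (hP : Pᵀ = P) (h v : (Fin n → ℝ) × ℝ) :
    fderiv ℝ (S.lyapunovForm P kp ki u) h v =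
      kp * (h.1 ⬝ᵥ P *ᵥ v.1) + ki * (h.2 - S.M u ⬝ᵥ h.1) * (v.2 - S.M u ⬝ᵥ v.1) := by
  have hd : HasFDerivAt (S.lyapunovForm P kp ki u) (fderiv ℝ (S.lyapunovForm P kp ki u) h) h :=
    ((S.contDiff_lyapunovForm P kp ki u (k := 1)).differentiable one_ne_zero h).hasFDerivAt
  -- The differential is read off from the derivative along the line `h + t v`, computed in two
  -- ways.
  have hline : ∀ {Y : Type} [NormedAddCommGroup Y] [NormedSpace ℝ Y] (a w : Y),
      HasDerivAt (fun t : ℝ => a + t • w) w 0 := fun a w => by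
    simpa using ((hasDerivAt_id (0 : ℝ)).smul_const w).const_add a
  have hd' : HasFDerivAt (S.lyapunovForm P kp ki u) (fderiv ℝ (S.lyapunovForm P kp ki u) h)
      (h + (0 : ℝ) • v) := by simpa using hd
  have h1 : HasDerivAt (fun t : ℝ => S.lyapunovForm P kp ki u (h + t • v))
      (fderiv ℝ (S.lyapunovForm P kp ki u) h v) 0 := by
    have hl : HasDerivAt (fun t : ℝ => h + t • v) v 0 := hline h v
    have h := hd'.comp_hasDerivAt (0 : ℝ) hl
    exact h
  have h2 : HasDerivAt (fun t : ℝ => S.lyapunovForm P kp ki u (h + t • v))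
      (kp / 2 * (v.1 ⬝ᵥ P *ᵥ h.1 + h.1 ⬝ᵥ P *ᵥ v.1) +
        ki / 2 * (2 * (h.2 - S.M u ⬝ᵥ h.1) * (v.2 - S.M u ⬝ᵥ v.1))) 0 := by
    have hq := hasDerivAt_dotProduct_mulVec (hline h.1 v.1) (hline h.1 v.1) P
    have hl : HasDerivAt (fun t : ℝ => (h.2 + t • v.2) - S.M u ⬝ᵥ (h.1 + t • v.1))
        (v.2 - S.M u ⬝ᵥ v.1) 0 := by
      refine (hline h.2 v.2).sub ?_
      simpa only [dotProduct_add, dotProduct_smul] using hline (S.M u ⬝ᵥ h.1) (S.M u ⬝ᵥ v.1)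
    have := (hq.const_mul (kp / 2)).add ((hl.pow 2).const_mul (ki / 2))
    simpa only [zero_smul, add_zero, Nat.cast_ofNat, Nat.add_one_sub_one, pow_one] using! this
  have hsymm : v.1 ⬝ᵥ P *ᵥ h.1 = h.1 ⬝ᵥ P *ᵥ v.1 := by
    rw [Matrix.dotProduct_mulVec, dotProduct_comm, ← Matrix.mulVec_transpose, hP]
  rw [h1.unique h2, hsymm]
  ring

theorem equil_eq {xss : Fin n → ℝ} (hF : IsUnit (S.F u).det)
    (hx : (S.A + u • S.B) *ᵥ xss + u • S.b + S.E = 0) : S.equil u = xss := by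
  have h : u • S.b + S.E = -(S.F u *ᵥ xss) := by
    rw [F, eq_neg_iff_add_eq_zero, ← hx]
    abel
  rw [equil, h, Matrix.mulVec_neg, neg_neg, Matrix.mulVec_mulVec, Matrix.nonsing_inv_mul _ hF,
    Matrix.one_mulVec]

/-- The closed loop in error coordinates. -/
theorem closedLoop_eq {xss : Fin n → ℝ} {lo hi r : ℝ} (hF : IsUnit (S.F u).det)
    (hx : (S.A + u • S.B) *ᵥ xss + u • S.b + S.E = 0) (hr : S.C ⬝ᵥ xss - r = 0)
    (φ : (Fin n → ℝ) → ℝ → ℝ) (ξ : (Fin n → ℝ) × ℝ) :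
    S.closedLoop lo hi r u φ ξ =
      (S.F u *ᵥ (ξ.1 - xss) +
        (sat lo hi (u + φ ξ.1 ξ.2) - u) • (S.B *ᵥ (ξ.1 - xss) + S.g u), S.C ⬝ᵥ (ξ.1 - xss)) := by
  have hg : S.B *ᵥ (ξ.1 - xss) + S.g u = S.B *ᵥ ξ.1 + S.b := by
    rw [g, S.equil_eq hF hx, Matrix.mulVec_sub]
    abel
  refine Prod.ext ?_ ?_
  · have h : S.F u *ᵥ xss = -(u • S.b + S.E) := by
      rw [F, eq_neg_iff_add_eq_zero, ← hx]
      abel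
    simp only [closedLoop, hg]
    rw [Matrix.mulVec_sub, h, F, Matrix.add_mulVec, Matrix.smul_mulVec, sub_smul,
      smul_add u (S.B *ᵥ ξ.1)]
    abel
  · rw [sub_eq_zero] at hr
    simp [closedLoop, dotProduct_sub, hr]

/-- The forwarding identity `M F = C`: it removes the drift from `z - Mh`. -/
theorem M_dotProduct_F_mulVec (hF : IsUnit (S.F u).det) (x : Fin n → ℝ) :
    S.M u ⬝ᵥ (S.F u *ᵥ x) = S.C ⬝ᵥ x := by
  rw [M, ← Matrix.dotProduct_mulVec, Matrix.mulVec_mulVec, Matrix.nonsing_inv_mul _ hF,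
    Matrix.one_mulVec]

/-- Dissipation of the forwarding Lyapunov function along the closed loop. -/
theorem fderiv_lyapunovForm_closedLoop {Q : Matrix (Fin n) (Fin n) ℝ} {xss : Fin n → ℝ}
    {lo hi r : ℝ} (hF : IsUnit (S.F u).det)
    (hx : (S.A + u • S.B) *ᵥ xss + u • S.b + S.E = 0) (hr : S.C ⬝ᵥ xss - r = 0)
    (hPs : Pᵀ = P) (hP : (S.F u)ᵀ * P + P * S.F u = -(2 : ℝ) • Q) (ξ : (Fin n → ℝ) × ℝ) :
    fderiv ℝ (S.lyapunovForm P kp ki u) (ξ - (xss, 0))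
        (S.closedLoop lo hi r u (S.forwardingFeedback P kp ki u xss) ξ) =
      -(kp * ((ξ.1 - xss) ⬝ᵥ Q *ᵥ (ξ.1 - xss)) +
        (sat lo hi (u + S.forwardingFeedback P kp ki u xss ξ.1 ξ.2) - u) *
          S.forwardingFeedback P kp ki u xss ξ.1 ξ.2) := by
  rw [S.fderiv_lyapunovForm hPs, S.closedLoop_eq hF hx hr]
  simp only [Prod.fst_sub, Prod.snd_sub, sub_zero]
  set h := ξ.1 - xss
  set s := sat lo hi (u + S.forwardingFeedback P kp ki u xss ξ.1 ξ.2) - u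
  -- The feedback is minus the derivative of the Lyapunov function along `(B h + g, 0)`.
  have hφ : S.forwardingFeedback P kp ki u xss ξ.1 ξ.2 =
      -(kp * (h ⬝ᵥ P *ᵥ (S.B *ᵥ h + S.g u)) -
        ki * (ξ.2 - S.M u ⬝ᵥ h) * (S.M u ⬝ᵥ (S.B *ᵥ h + S.g u))) := by
    rw [forwardingFeedback, dotProduct_sub, dotProduct_smul, dotProduct_smul, smul_eq_mul,
      smul_eq_mul, dotProduct_comm _ (h ᵥ* P), ← Matrix.dotProduct_mulVec,
      dotProduct_comm _ (S.M u)]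
  have hlyap := lyapunov_dotProduct hP h h
  have hsymm : (S.F u *ᵥ h) ⬝ᵥ P *ᵥ h = h ⬝ᵥ P *ᵥ (S.F u *ᵥ h) := by
    rw [Matrix.dotProduct_mulVec, dotProduct_comm, ← Matrix.mulVec_transpose, hPs]
  rw [hsymm, Matrix.smul_mulVec, dotProduct_smul, smul_eq_mul] at hlyap
  rw [hφ, Matrix.mulVec_add, dotProduct_add, dotProduct_add, S.M_dotProduct_F_mulVec hF,
    Matrix.mulVec_smul, dotProduct_smul, dotProduct_smul, smul_eq_mul, smul_eq_mul]
  linear_combination kp / 2 * hlyap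

/-- Near the equilibrium, where the saturation is inactive, the dissipation is quadratic. -/
theorem exists_dissipation_ge {Q : Matrix (Fin n) (Fin n) ℝ} {xss : Fin n → ℝ} {lo hi : ℝ}
    (hQ : ∀ x ≠ 0, 0 < x ⬝ᵥ Q *ᵥ x) (hkp : 0 < kp) (hki : 0 < ki) (hu : u ∈ Set.Ioo lo hi)
    (hGain : S.C ⬝ᵥ ((S.F u)⁻¹ *ᵥ S.g u) ≠ 0) :
    ∃ c > 0, ∃ ρ > 0, ∀ ξ : (Fin n → ℝ) × ℝ, ‖ξ - (xss, 0)‖ < ρ →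
      c * ‖ξ - (xss, 0)‖ ^ 2 ≤ kp * ((ξ.1 - xss) ⬝ᵥ Q *ᵥ (ξ.1 - xss)) +
        (sat lo hi (u + S.forwardingFeedback P kp ki u xss ξ.1 ξ.2) - u) *
          S.forwardingFeedback P kp ki u xss ξ.1 ξ.2 := by
  obtain ⟨K, hK, hKq⟩ := exists_abs_le_mul_norm_sq
    (S.contDiff_quadraticFeedback P kp ki u (k := 0)).continuous
    (S.quadraticFeedback_smul P kp ki u)
  -- For `φ = ℓ + q`, with linear part `ℓ` and quadratic part `q`, one has `φ² ≥ ℓ²/2 - q²`. The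
  -- form with `ℓ²/2` is positive definite by the gain condition, and `q²` is of fourth order.
  have hQc : Continuous fun h : (Fin n → ℝ) × ℝ =>
      kp * (h.1 ⬝ᵥ Q *ᵥ h.1) + S.linearFeedback P kp ki u h ^ 2 / 2 := by
    have := (S.contDiff_linearFeedback P kp ki u (k := 0)).continuous
    fun_prop
  obtain ⟨a, ha, hale⟩ := exists_mul_norm_sq_le hQc
    (fun t h => by
      simp only [linearFeedback_smul, Prod.smul_fst, Matrix.mulVec_smul, smul_dotProduct,
        dotProduct_smul, smul_eq_mul]
      ring)
    (fun h h0 => by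
      by_cases h1 : h.1 = 0
      · have h2 : h.2 ≠ 0 := fun h2 => h0 (Prod.ext h1 h2)
        have : S.linearFeedback P kp ki u h ≠ 0 := by
          rw [S.linearFeedback_of_fst_eq_zero h1]
          exact mul_ne_zero (mul_ne_zero hki.ne' h2) hGain
        simp only [h1, zero_dotProduct, mul_zero, zero_add]
        positivity
      · have := hQ _ h1
        positivity)
  have hφc : Continuous fun ξ : (Fin n → ℝ) × ℝ =>
      u + S.forwardingFeedback P kp ki u xss ξ.1 ξ.2 :=
    continuous_const.add (S.contDiff_forwardingFeedback P kp ki u xss (k := 0)).continuous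
  have hφ0 : S.forwardingFeedback P kp ki u xss xss 0 = 0 := by simp [forwardingFeedback]
  have hnhds : ∀ᶠ ξ : (Fin n → ℝ) × ℝ in nhds (xss, 0),
      u + S.forwardingFeedback P kp ki u xss ξ.1 ξ.2 ∈ Set.Icc lo hi := by
    refine hφc.continuousAt.eventually_mem (Icc_mem_nhds ?_ ?_) <;> simp only [hφ0, add_zero]
    exacts [hu.1, hu.2]
  obtain ⟨ρ, hρ, hball⟩ := Metric.eventually_nhds_iff.1 hnhds
  -- The second radius ensures `q² ≤ (a/2) ‖h‖²`, which leaves half of the coercivity constant `a`.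
  refine ⟨a / 2, by positivity, min ρ (√(a / 2) / K), by positivity, fun ξ hξ => ?_⟩
  have hmem := hball (y := ξ) (by rw [dist_eq_norm]; exact hξ.trans_le (min_le_left _ _))
  rw [sat_of_mem hmem, add_sub_cancel_left, forwardingFeedback_eq]
  have hsub : ((ξ.1 - xss, ξ.2) : (Fin n → ℝ) × ℝ) = ξ - (xss, 0) := by
    ext <;> simp
  have hfst : ξ.1 - xss = (ξ - (xss, 0)).1 := rfl
  rw [hsub, hfst]
  set h := ξ - (xss, 0)
  have hn : K ^ 2 * ‖h‖ ^ 2 ≤ a / 2 := by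
    have h1 : ‖h‖ * K ≤ √(a / 2) := by
      rw [← le_div_iff₀ hK]
      exact hξ.le.trans (min_le_right _ _)
    calc K ^ 2 * ‖h‖ ^ 2 = (‖h‖ * K) ^ 2 := by ring
      _ ≤ √(a / 2) ^ 2 := by gcongr
      _ = a / 2 := Real.sq_sqrt (by positivity)
  have hq : S.quadraticFeedback P kp ki u h ^ 2 ≤ a / 2 * ‖h‖ ^ 2 := by
    calc S.quadraticFeedback P kp ki u h ^ 2 = |S.quadraticFeedback P kp ki u h| ^ 2 :=
          (sq_abs _).symm
      _ ≤ (K * ‖h‖ ^ 2) ^ 2 := by gcongr; exact hKq h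
      _ = K ^ 2 * ‖h‖ ^ 2 * ‖h‖ ^ 2 := by ring
      _ ≤ a / 2 * ‖h‖ ^ 2 := by gcongr
  have := hale h
  -- `(ℓ + q)² - ℓ²/2 + q² = (ℓ + 2q)²/2`.
  nlinarith [sq_nonneg (S.linearFeedback P kp ki u h + 2 * S.quadraticFeedback P kp ki u h)]

end BilinearSystem

end

/-! ### Stability of the closed loop -/

theorem theorem1 {n : ℕ} (S : BilinearSystem n) (lo hi : ℝ)
    (hHurwitz : ∀ u ∈ Set.Icc lo hi, IsHurwitz (S.F u))
    (hGain : ∀ u ∈ Set.Icc lo hi, S.C ⬝ᵥ ((S.F u)⁻¹ *ᵥ S.g u) ≠ 0)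
    (r uss : ℝ) (xss : Fin n → ℝ) (huss : uss ∈ Set.Ioo lo hi)
    (hx : (S.A + uss • S.B) *ᵥ xss + uss • S.b + S.E = 0)
    (hr : S.C ⬝ᵥ xss - r = 0)
    (Upsilon P : Matrix (Fin n) (Fin n) ℝ) (hUpsilon : Upsilon.PosDef)
    (hP : (S.F uss)ᵀ * P + P * S.F uss = -(2 : ℝ) • Upsilon)
    (kp ki : ℝ) (hkp : 0 < kp) (hki : 0 < ki) :
    IsGloballyAsymptoticallyStable
        (S.closedLoop lo hi r uss (S.forwardingFeedback P kp ki uss xss)) (xss, 0) ∧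
      IsLocallyExponentiallyStable
        (S.closedLoop lo hi r uss (S.forwardingFeedback P kp ki uss xss)) (xss, 0) := by
  have hH := hHurwitz uss (Set.Ioo_subset_Icc_self huss)
  have hG := hGain uss (Set.Ioo_subset_Icc_self huss)
  have hF := hH.isUnit_det
  have hQ : ∀ x ≠ 0, 0 < x ⬝ᵥ Upsilon *ᵥ x := fun x hx0 => by
    simpa using hUpsilon.dotProduct_mulVec_pos hx0
  have hUs : Upsilonᵀ = Upsilon := by simpa using hUpsilon.isHermitian.eq
  have hPs : Pᵀ = P := hH.transpose_eq_of_lyapunov hP (by rw [Matrix.transpose_smul, hUs])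
  have hPpos : ∀ x ≠ 0, 0 < x ⬝ᵥ P *ᵥ x := fun x hx0 =>
    hH.pos_of_lyapunov hP (fun y hy => by
      have := hQ y hy
      rw [Matrix.smul_mulVec, dotProduct_smul, smul_eq_mul]
      linarith) hx0
  have hVc : ContDiff ℝ 1 (S.lyapunovForm P kp ki uss) := S.contDiff_lyapunovForm P kp ki uss
  obtain ⟨a, ha, hlow⟩ := exists_mul_norm_sq_le hVc.continuous (S.lyapunovForm_smul P kp ki uss)
    (fun h h0 => S.lyapunovForm_pos hkp hki hPpos h0)
  obtain ⟨b, hb, hup⟩ := exists_abs_le_mul_norm_sq hVc.continuous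
    (S.lyapunovForm_smul P kp ki uss)
  obtain ⟨c, hc, ρ, hρ, hdiss⟩ := S.exists_dissipation_ge (P := P) (xss := xss) hQ hkp hki huss hG
  have hV : ∀ ξ : (Fin n → ℝ) × ℝ,
      HasFDerivAt (fun ξ => S.lyapunovForm P kp ki uss (ξ - (xss, 0)))
        (fderiv ℝ (S.lyapunovForm P kp ki uss) (ξ - (xss, 0))) ξ := fun ξ =>
    (hVc.differentiable one_ne_zero _).hasFDerivAt.comp ξ ((hasFDerivAt_id ξ).sub_const (xss, 0))
  have hdec := S.fderiv_lyapunovForm_closedLoop (kp := kp) (ki := ki) (lo := lo) (hi := hi)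
    hF hx hr hPs hP
  have hφc := (S.contDiff_forwardingFeedback P kp ki uss xss (k := 0)).continuous
  have hφ0 : S.forwardingFeedback P kp ki uss xss xss 0 = 0 := by
    simp [BilinearSystem.forwardingFeedback]
  have hGAS := isGloballyAsymptoticallyStable_of_lyapunov
    (S.locallyLipschitz_closedLoop P kp ki uss lo hi r xss) (p := (xss, 0))
    (by
      rw [S.closedLoop_eq hF hx hr, hφ0, add_zero,
        sat_of_mem (Set.Ioo_subset_Icc_self huss)]
      simp) hV ha hb (fun ξ => hlow _) (fun ξ => (le_abs_self _).trans (hup _))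
    (W := fun ξ => kp * ((ξ.1 - xss) ⬝ᵥ Upsilon *ᵥ (ξ.1 - xss)) +
      (sat lo hi (uss + S.forwardingFeedback P kp ki uss xss ξ.1 ξ.2) - uss) *
        S.forwardingFeedback P kp ki uss xss ξ.1 ξ.2)
    (by
      have := continuous_sat (lo := lo) (hi := hi)
      fun_prop) (by simp [hφ0])
    (fun ξ hξ => by
      -- With zero state error only the integrator can dissipate, and it does so through the nonzero
      -- gain.
      by_cases h1 : ξ.1 - xss = 0
      · have h2 : ξ.2 ≠ 0 := fun h2 => hξ (Prod.ext (sub_eq_zero.1 h1) h2)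
        have hφ : S.forwardingFeedback P kp ki uss xss ξ.1 ξ.2 ≠ 0 := by
          rw [S.forwardingFeedback_eq, S.linearFeedback_of_fst_eq_zero h1,
            S.quadraticFeedback_of_fst_eq_zero h1, add_zero]
          exact mul_ne_zero (mul_ne_zero hki.ne' h2) hG
        simpa [h1] using sat_sub_mul_pos huss hφ
      · exact add_pos_of_pos_of_nonneg (mul_pos hkp (hQ _ h1)) (sat_sub_mul_nonneg huss))
    hdec
  exact ⟨hGAS, hGAS.isLocallyExponentiallyStable hV ha hb hc hρ (fun ξ => hlow _)
    (fun ξ => (le_abs_self _).trans (hup _)) fun ξ hξ => by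
      rw [hdec]
      exact neg_le_neg (hdiss ξ hξ)⟩
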